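/- Let $\Omega\subset\mathbb R^2$ be a nonempty bounded open set. Let $D_x,D_y,u,v:\Omega\to\mathbb R$ be bounded measurable functions with $\inf_\Omega D_x>0$ and $\inf_\Omega D_y>0$, let $\mu>0$ be a constant, let $q\in L^2(\Omega)$, and let the velocity $\bar u=(u,v)$ be incompressible, i.e. $\nabla\cdot\bar u=0$ in $\Omega$ in the sense of distributions: $\int_\Omega \bar u\cdot\nabla\varphi=0$ for all $\varphi\in C_c^\infty(\Omega)$ (for $C^1$ fields it is enough that $\partial u/\partial x+\partial v/\partial y=0$ pointwise in $\Omega$). Let $\|\cdot\|$ be the norm of $L^2(\Omega)$ and $\|w\|_1=(\|w\|^2+\|\partial w/\partial x\|^2+\|\partial w/\partial y\|^2)^{1/2}$ the norm of $H^1(\Omega)$, with weak derivatives, and let $V=H^1_0(\Omega)$ be the closure of $C_c^\infty(\Omega)$ in $H^1(\Omega)$. For $c,d\in V$ put $$a(c,d)=\int_\Omega D_x\frac{\partial c}{\partial x}\frac{\partial d}{\partial x}+\int_\Omega D_y\frac{\partial c}{\partial y}\frac{\partial d}{\partial y}+\int_\Omega d\,\bar u\cdot\nabla c+\int_\Omega\mu\,c\,d,\qquad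 l(d)=\int_\Omega q\,d .$$ Then: (i) $a$ is a bilinear form on $V$ and $|a(c,d)|\le N_a\|c\|_1\|d\|_1$ for all $c,d\in V$, where $N_a=D_1+D_2+U+V_0+|\mu|$ with $D_1=\sup_\Omega|D_x|$, $D_2=\sup_\Omega|D_y|$, $U=\sup_\Omega|u|$, $V_0=\sup_\Omega|v|$; (ii) $\int_\Omega d\,\bar u\cdot\nabla d=0$ for all $d\in V$, and $a(d,d)\ge K_a\|d\|_1^2$ for all $d\in V$, where $K_a=\min\{\inf_\Omega D_x,\ \inf_\Omega D_y,\ \mu\}>0$; (iii) $l$ is a linear functional on $V$ and $|l(d)|\le\|q\|\,\|d\|_1$ for all $d\in V$; (iv) there is exactly one $c\in V$ such that $a(c,d)=l(d)$ for all $d\in V$. -/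

import Mathlib

open MeasureTheory
open scoped ContDiff

noncomputable section

namespace ADR

/-- The real Hilbert space `L²(Ω)` (classes of functions modulo equality a.e. on `Ω`). -/
abbrev L2 (Ω : Set (ℝ × ℝ)) : Type := Lp ℝ 2 (volume.restrict Ω)

/-- The unit vector in the `x`-direction. -/
def ex : ℝ × ℝ := (1, 0)

/-- The unit vector in the `y`-direction. -/
def ey : ℝ × ℝ := (0, 1)

/-- `φ ∈ C_c^∞(Ω)`. -/
structure IsTestFunction (Ω : Set (ℝ × ℝ)) (φ : ℝ × ℝ → ℝ) : Prop where
  smooth : ContDiff ℝ ∞ φ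
  compact : HasCompactSupport φ
  support : tsupport φ ⊆ Ω

/-- `g ∈ L²(Ω)` is the weak partial derivative of `f ∈ L²(Ω)` in the direction `e`. -/
def HasWeakPartial (Ω : Set (ℝ × ℝ)) (e : ℝ × ℝ) (f g : L2 Ω) : Prop :=
  ∀ φ : ℝ × ℝ → ℝ, IsTestFunction Ω φ →
    ∫ p in Ω, f p * fderiv ℝ φ p e = - ∫ p in Ω, g p * φ p

open Classical in
/-- The weak partial derivative of `f` in the direction `e`, as an element of `L²(Ω)`
(and `0` if there is none; it is only used for `f ∈ H¹(Ω)`). -/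
def weakPartial {Ω : Set (ℝ × ℝ)} (e : ℝ × ℝ) (f : L2 Ω) : L2 Ω :=
  if h : ∃ g : L2 Ω, HasWeakPartial Ω e f g then h.choose else 0

theorem hasWeakPartial_weakPartial {Ω : Set (ℝ × ℝ)} {e : ℝ × ℝ} {f : L2 Ω}
    (h : ∃ g : L2 Ω, HasWeakPartial Ω e f g) : HasWeakPartial Ω e f (weakPartial e f) := by
  rw [weakPartial, dif_pos h]
  exact h.choose_spec

theorem memLp_of_continuous {Ω : Set (ℝ × ℝ)} {φ : ℝ × ℝ → ℝ} (hφ : Continuous φ)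
    (hc : HasCompactSupport φ) : MemLp φ 2 (volume.restrict Ω) :=
  (hφ.memLp_of_hasCompactSupport hc (μ := volume)).restrict Ω

theorem IsTestFunction.memLp {Ω : Set (ℝ × ℝ)} {φ : ℝ × ℝ → ℝ} (hφ : IsTestFunction Ω φ) :
    MemLp φ 2 (volume.restrict Ω) :=
  memLp_of_continuous hφ.smooth.continuous hφ.compact

theorem IsTestFunction.memLp_fderiv {Ω : Set (ℝ × ℝ)} {φ : ℝ × ℝ → ℝ}
    (hφ : IsTestFunction Ω φ) (e : ℝ × ℝ) :
    MemLp (fun p => fderiv ℝ φ p e) 2 (volume.restrict Ω) :=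
  memLp_of_continuous ((hφ.smooth.continuous_fderiv (by simp)).clm_apply continuous_const)
    (hφ.compact.fderiv_apply ℝ e)

theorem HasWeakPartial.add {Ω : Set (ℝ × ℝ)} {e : ℝ × ℝ} {f₁ f₂ g₁ g₂ : L2 Ω}
    (h₁ : HasWeakPartial Ω e f₁ g₁) (h₂ : HasWeakPartial Ω e f₂ g₂) :
    HasWeakPartial Ω e (f₁ + f₂) (g₁ + g₂) := by
  intro φ hφ
  have key : ∀ (a b : L2 Ω) (ψ : ℝ × ℝ → ℝ), MemLp ψ 2 (volume.restrict Ω) →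
      ∫ p in Ω, (a + b : L2 Ω) p * ψ p = (∫ p in Ω, a p * ψ p) + ∫ p in Ω, b p * ψ p := by
    intro a b ψ hψ
    have ia : Integrable (fun p => a p * ψ p) (volume.restrict Ω) :=
      (Lp.memLp a).integrable_mul hψ
    have ib : Integrable (fun p => b p * ψ p) (volume.restrict Ω) :=
      (Lp.memLp b).integrable_mul hψ
    rw [← integral_add ia ib]
    refine integral_congr_ae ?_
    filter_upwards [Lp.coeFn_add a b] with p hp
    rw [hp, Pi.add_apply, add_mul]
  rw [key _ _ _ (hφ.memLp_fderiv e), key _ _ _ hφ.memLp, h₁ φ hφ, h₂ φ hφ]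
  ring

theorem HasWeakPartial.smul {Ω : Set (ℝ × ℝ)} {e : ℝ × ℝ} {f g : L2 Ω} (r : ℝ)
    (h : HasWeakPartial Ω e f g) : HasWeakPartial Ω e (r • f) (r • g) := by
  intro φ hφ
  have key : ∀ (a : L2 Ω) (ψ : ℝ × ℝ → ℝ),
      ∫ p in Ω, (r • a : L2 Ω) p * ψ p = r * ∫ p in Ω, a p * ψ p := by
    intro a ψ
    rw [← integral_const_mul]
    refine integral_congr_ae ?_
    filter_upwards [Lp.coeFn_smul r a] with p hp
    rw [hp, Pi.smul_apply, smul_eq_mul, mul_assoc]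
  rw [key, key, h φ hφ]
  ring

theorem hasWeakPartial_zero (Ω : Set (ℝ × ℝ)) (e : ℝ × ℝ) : HasWeakPartial Ω e 0 0 := by
  intro φ hφ
  have key : ∀ ψ : ℝ × ℝ → ℝ, ∫ p in Ω, (0 : L2 Ω) p * ψ p = 0 := by
    intro ψ
    refine integral_eq_zero_of_ae ?_
    filter_upwards [Lp.coeFn_zero ℝ 2 (volume.restrict Ω)] with p hp
    rw [hp]
    simp
  rw [key, key, neg_zero]

/-- Weak partial derivatives are unique. -/
theorem HasWeakPartial.unique {Ω : Set (ℝ × ℝ)} (hΩ : IsOpen Ω) {e : ℝ × ℝ} {f g₁ g₂ : L2 Ω}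
    (h₁ : HasWeakPartial Ω e f g₁) (h₂ : HasWeakPartial Ω e f g₂) : g₁ = g₂ := by
  have h0 : HasWeakPartial Ω e 0 (g₁ + (-1 : ℝ) • g₂) := by
    have := h₁.add (h₂.smul (-1))
    rwa [neg_one_smul, add_neg_cancel] at this
  set g : L2 Ω := g₁ + (-1 : ℝ) • g₂ with hg
  have hloc : LocallyIntegrableOn (g : ℝ × ℝ → ℝ) Ω volume := by
    rw [locallyIntegrableOn_iff hΩ.isLocallyClosed]
    intro K hK hKc
    have := (Lp.memLp g).locallyIntegrable (by norm_num)
    have h2 := this.integrableOn_isCompact hKc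
    rwa [IntegrableOn, Measure.restrict_restrict hKc.measurableSet,
      Set.inter_eq_left.mpr hK] at h2
  have hz := hΩ.ae_eq_zero_of_integral_contDiff_smul_eq_zero hloc (by
    intro φ hs hc ht
    have h3 := h0 φ ⟨hs, hc, ht⟩
    have h4 : ∫ p in Ω, (0 : L2 Ω) p * fderiv ℝ φ p e = 0 := by
      refine integral_eq_zero_of_ae ?_
      filter_upwards [Lp.coeFn_zero ℝ 2 (volume.restrict Ω)] with p hp
      rw [hp]
      simp
    rw [h4] at h3
    rw [← setIntegral_eq_integral_of_forall_compl_eq_zero (s := Ω)]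
    · have : ∫ p in Ω, φ p • g p = ∫ p in Ω, g p * φ p := by
        simp only [smul_eq_mul, mul_comm]
      rw [this]
      linarith
    · intro p hp
      rw [image_eq_zero_of_notMem_tsupport (fun h => hp (ht h)), zero_smul])
  have hg0 : g = 0 := by
    rw [Lp.eq_zero_iff_ae_eq_zero]
    exact (ae_restrict_iff' hΩ.measurableSet).mpr hz
  rw [hg, neg_one_smul, ← sub_eq_add_neg] at hg0
  exact sub_eq_zero.mp hg0

/-- The Sobolev space `H¹(Ω)`: those `f ∈ L²(Ω)` whose two first order weak partial derivatives
exist in `L²(Ω)`. -/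
def H1 (Ω : Set (ℝ × ℝ)) : Submodule ℝ (L2 Ω) where
  carrier := {f | (∃ g : L2 Ω, HasWeakPartial Ω ex f g) ∧ ∃ g : L2 Ω, HasWeakPartial Ω ey f g}
  add_mem' := by
    rintro f₁ f₂ ⟨⟨a, ha⟩, b, hb⟩ ⟨⟨a', ha'⟩, b', hb'⟩
    exact ⟨⟨_, ha.add ha'⟩, _, hb.add hb'⟩
  zero_mem' := ⟨⟨0, hasWeakPartial_zero Ω ex⟩, 0, hasWeakPartial_zero Ω ey⟩
  smul_mem' := by
    rintro r f ⟨⟨a, ha⟩, b, hb⟩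
    exact ⟨⟨_, ha.smul r⟩, _, hb.smul r⟩

/-- The `H¹` norm `(‖f‖² + ‖∂f/∂x‖² + ‖∂f/∂y‖²)^{1/2}`. -/
def normH1 {Ω : Set (ℝ × ℝ)} (f : L2 Ω) : ℝ :=
  Real.sqrt (‖f‖ ^ 2 + ‖weakPartial ex f‖ ^ 2 + ‖weakPartial ey f‖ ^ 2)

/-- The space `H¹₀(Ω)`: the closure of `C_c^∞(Ω)` in `H¹(Ω)` for the `H¹` norm. -/
def H10Set (Ω : Set (ℝ × ℝ)) : Set (L2 Ω) :=
  {f | f ∈ H1 Ω ∧ ∀ ε : ℝ, 0 < ε → ∃ φ : ℝ × ℝ → ℝ, IsTestFunction Ω φ ∧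
    ∃ w ∈ H1 Ω, w =ᵐ[volume.restrict Ω] φ ∧ normH1 (f - w) < ε}

theorem weakPartial_eq {Ω : Set (ℝ × ℝ)} (hΩ : IsOpen Ω) {e : ℝ × ℝ} {f g : L2 Ω}
    (h : HasWeakPartial Ω e f g) : weakPartial e f = g :=
  (hasWeakPartial_weakPartial ⟨g, h⟩).unique hΩ h

theorem normH1_add_le {Ω : Set (ℝ × ℝ)} (hΩ : IsOpen Ω) {f₁ f₂ : L2 Ω} (h₁ : f₁ ∈ H1 Ω)
    (h₂ : f₂ ∈ H1 Ω) : normH1 (f₁ + f₂) ≤ normH1 f₁ + normH1 f₂ := by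
  have hx := weakPartial_eq hΩ
    ((hasWeakPartial_weakPartial h₁.1).add (hasWeakPartial_weakPartial h₂.1))
  have hy := weakPartial_eq hΩ
    ((hasWeakPartial_weakPartial h₁.2).add (hasWeakPartial_weakPartial h₂.2))
  have key : ∀ a b c : L2 Ω, Real.sqrt (‖a‖ ^ 2 + ‖b‖ ^ 2 + ‖c‖ ^ 2)
      = ‖(WithLp.toLp 2 ![a, b, c] : PiLp 2 (fun _ : Fin 3 => L2 Ω))‖ := by
    intro a b c
    rw [PiLp.norm_eq_of_L2]
    simp [Fin.sum_univ_three]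
  simp only [normH1]
  rw [hx, hy, key, key, key]
  refine le_trans (le_of_eq ?_) (norm_add_le _ _)
  rw [← WithLp.toLp_add]
  simp

theorem normH1_smul {Ω : Set (ℝ × ℝ)} (hΩ : IsOpen Ω) (r : ℝ) {f : L2 Ω} (h : f ∈ H1 Ω) :
    normH1 (r • f) = |r| * normH1 f := by
  have hx := weakPartial_eq hΩ ((hasWeakPartial_weakPartial h.1).smul r)
  have hy := weakPartial_eq hΩ ((hasWeakPartial_weakPartial h.2).smul r)
  simp only [normH1]
  rw [hx, hy, norm_smul, norm_smul, norm_smul, Real.norm_eq_abs]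
  rw [← Real.sqrt_sq (abs_nonneg r), ← Real.sqrt_mul (sq_nonneg _), Real.sqrt_sq (abs_nonneg r)]
  congr 1
  ring

/-- `H¹₀(Ω)` as a linear subspace of `L²(Ω)`, for an open set `Ω`. -/
def H10 (Ω : Set (ℝ × ℝ)) (hΩ : IsOpen Ω) : Submodule ℝ (L2 Ω) where
  carrier := H10Set Ω
  add_mem' := by
    rintro f₁ f₂ ⟨m₁, h₁⟩ ⟨m₂, h₂⟩
    refine ⟨(H1 Ω).add_mem m₁ m₂, fun ε hε => ?_⟩
    obtain ⟨φ₁, t₁, w₁, k₁, e₁, n₁⟩ := h₁ (ε / 2) (by linarith)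
    obtain ⟨φ₂, t₂, w₂, k₂, e₂, n₂⟩ := h₂ (ε / 2) (by linarith)
    refine ⟨φ₁ + φ₂, ⟨t₁.smooth.add t₂.smooth, t₁.compact.add t₂.compact, ?_⟩, w₁ + w₂,
      (H1 Ω).add_mem k₁ k₂, (Lp.coeFn_add w₁ w₂).trans (e₁.add e₂), ?_⟩
    · exact (tsupport_add φ₁ φ₂).trans (Set.union_subset t₁.support t₂.support)
    · rw [add_sub_add_comm]
      have := normH1_add_le hΩ ((H1 Ω).sub_mem m₁ k₁) ((H1 Ω).sub_mem m₂ k₂)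
      linarith
  zero_mem' := by
    refine ⟨(H1 Ω).zero_mem, fun ε hε => ⟨0, ⟨contDiff_const, HasCompactSupport.zero, ?_⟩, 0,
      (H1 Ω).zero_mem, Lp.coeFn_zero _ _ _, ?_⟩⟩
    · simp [tsupport]
    · have := normH1_smul hΩ 0 (H1 Ω).zero_mem
      rw [zero_smul, abs_zero, zero_mul] at this
      rw [sub_zero, this]
      exact hε
  smul_mem' := by
    rintro r f ⟨m, h⟩
    refine ⟨(H1 Ω).smul_mem r m, fun ε hε => ?_⟩
    obtain ⟨φ, t, w, k, e, n⟩ := h (ε / (|r| + 1)) (by positivity)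
    refine ⟨fun p => r * φ p, ⟨contDiff_const.mul t.smooth, t.compact.mul_left, ?_⟩, r • w,
      (H1 Ω).smul_mem r k, ?_, ?_⟩
    · exact (tsupport_mul_subset_right (f := fun _ => r) (g := φ)).trans t.support
    · filter_upwards [Lp.coeFn_smul r w, e] with p hp hq
      rw [hp, Pi.smul_apply, hq, smul_eq_mul]
    · rw [← smul_sub, normH1_smul hΩ r ((H1 Ω).sub_mem m k)]
      have h1 : |r| * normH1 (f - w) ≤ |r| * (ε / (|r| + 1)) :=
        mul_le_mul_of_nonneg_left n.le (abs_nonneg r)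
      refine lt_of_le_of_lt h1 ?_
      rw [← mul_div_assoc, div_lt_iff₀ (by positivity)]
      nlinarith [abs_nonneg r]

/-- Incompressibility `∇ · (u, v) = 0` on `Ω`, in the sense of distributions. -/
def DivergenceFree (Ω : Set (ℝ × ℝ)) (u v : ℝ × ℝ → ℝ) : Prop :=
  ∀ φ : ℝ × ℝ → ℝ, IsTestFunction Ω φ →
    ∫ p in Ω, (u p * fderiv ℝ φ p ex + v p * fderiv ℝ φ p ey) = 0

/-- A `C¹` velocity with pointwise vanishing divergence is divergence free. -/
theorem DivergenceFree.of_pointwise {Ω : Set (ℝ × ℝ)} (hΩ : IsOpen Ω) {u v : ℝ × ℝ → ℝ}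
    (hu : ContDiffOn ℝ 1 u Ω) (hv : ContDiffOn ℝ 1 v Ω)
    (hdiv : ∀ p ∈ Ω, fderiv ℝ u p ex + fderiv ℝ v p ey = 0) : DivergenceFree Ω u v := by
  intro φ hφ
  have hsm : ∀ (f ψ : ℝ × ℝ → ℝ), ContinuousOn f Ω → Continuous ψ → tsupport ψ ⊆ tsupport φ →
      Integrable (fun p => f p * ψ p) := by
    intro f ψ hf hψ hs
    have hc : HasCompactSupport ψ := hφ.compact.of_isClosed_subset (isClosed_tsupport ψ) hs
    refine Continuous.integrable_of_hasCompactSupport ?_ hc.mul_left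
    rw [continuous_iff_continuousAt]
    intro p
    by_cases hp : p ∈ tsupport ψ
    · exact (hf.continuousAt (hΩ.mem_nhds (hφ.support (hs hp)))).mul hψ.continuousAt
    · have : (fun q => f q * ψ q) =ᶠ[nhds p] fun _ => 0 := by
        filter_upwards [(isClosed_tsupport ψ).isOpen_compl.mem_nhds hp] with q hq
        rw [image_eq_zero_of_notMem_tsupport hq, mul_zero]
      exact continuousAt_const.congr this.symm
  have hφd : ∀ e : ℝ × ℝ, Continuous (fun p => fderiv ℝ φ p e) := fun e =>
    (hφ.smooth.continuous_fderiv (by simp)).clm_apply continuous_const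
  have hφs : ∀ e : ℝ × ℝ, tsupport (fun p => fderiv ℝ φ p e) ⊆ tsupport φ := fun e =>
    tsupport_fderiv_apply_subset ℝ e
  have hd : ∀ (f : ℝ × ℝ → ℝ) (e : ℝ × ℝ), ContDiffOn ℝ 1 f Ω →
      ContinuousOn (fun p => fderiv ℝ f p e) Ω := fun f e hf =>
    (hf.continuousOn_fderiv_of_isOpen hΩ le_rfl).clm_apply continuousOn_const
  have parts : ∀ (f : ℝ × ℝ → ℝ) (e : ℝ × ℝ), ContDiffOn ℝ 1 f Ω →
      ∫ p, f p * fderiv ℝ φ p e = - ∫ p, fderiv ℝ f p e * φ p := by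
    intro f e hf
    refine integral_mul_fderiv_eq_neg_fderiv_mul_of_integrable
      (hsm _ _ (hd f e hf) hφ.smooth.continuous subset_rfl)
      (hsm _ _ hf.continuousOn (hφd e) (hφs e))
      (hsm _ _ hf.continuousOn hφ.smooth.continuous subset_rfl) ?_ ?_
    · intro p hp
      exact (hf.differentiableOn (by simp)).differentiableAt (hΩ.mem_nhds (hφ.support hp))
    · intro p _
      exact hφ.smooth.differentiable (by simp) p
  rw [setIntegral_eq_integral_of_forall_compl_eq_zero]
  · rw [integral_add (hsm _ _ hu.continuousOn (hφd ex) (hφs ex))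
      (hsm _ _ hv.continuousOn (hφd ey) (hφs ey)), parts u ex hu, parts v ey hv, ← neg_add,
      ← integral_add (hsm _ _ (hd u ex hu) hφ.smooth.continuous subset_rfl)
        (hsm _ _ (hd v ey hv) hφ.smooth.continuous subset_rfl), neg_eq_zero]
    refine integral_eq_zero_of_ae (Filter.Eventually.of_forall fun p => ?_)
    by_cases hp : p ∈ tsupport φ
    · have := hdiv p (hφ.support hp)
      simp only [Pi.zero_apply]
      rw [← add_mul, this, zero_mul]
    · simp [image_eq_zero_of_notMem_tsupport hp]
  · intro p hp
    have h1 : ∀ e, fderiv ℝ φ p e = 0 := fun e =>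
      image_eq_zero_of_notMem_tsupport (f := fun p => fderiv ℝ φ p e)
        (fun h => hp (hφ.support (hφs e h)))
    rw [h1, h1, mul_zero, mul_zero, add_zero]

/-- A coefficient on `Ω`: measurable and bounded on `Ω`. -/
structure IsBoundedCoeff (Ω : Set (ℝ × ℝ)) (f : ℝ × ℝ → ℝ) : Prop where
  measurable : AEMeasurable f (volume.restrict Ω)
  bounded : BddAbove ((fun p => |f p|) '' Ω)

/-- `sup_Ω |f|`. -/
def supAbs (Ω : Set (ℝ × ℝ)) (f : ℝ × ℝ → ℝ) : ℝ := sSup ((fun p => |f p|) '' Ω)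

/-- The advection term `∫_Ω d (u ∂c/∂x + v ∂c/∂y)`. -/
def advection {Ω : Set (ℝ × ℝ)} (u v : ℝ × ℝ → ℝ) (c d : L2 Ω) : ℝ :=
  ∫ p in Ω, d p * (u p * weakPartial ex c p + v p * weakPartial ey c p)

/-- The bilinear form `a(c, d)` of the weak formulation. -/
def bilin {Ω : Set (ℝ × ℝ)} (Dx Dy u v : ℝ × ℝ → ℝ) (μ : ℝ) (c d : L2 Ω) : ℝ :=
  (∫ p in Ω, Dx p * weakPartial ex c p * weakPartial ex d p) +
  (∫ p in Ω, Dy p * weakPartial ey c p * weakPartial ey d p) +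
  advection u v c d + ∫ p in Ω, μ * c p * d p

/-- The functional `l(d) = ∫_Ω q d`. -/
def source {Ω : Set (ℝ × ℝ)} (q d : L2 Ω) : ℝ := ∫ p in Ω, q p * d p

/-- `N_a = D₁ + D₂ + U + V + |μ|`. -/
def contConst (Ω : Set (ℝ × ℝ)) (Dx Dy u v : ℝ × ℝ → ℝ) (μ : ℝ) : ℝ :=
  supAbs Ω Dx + supAbs Ω Dy + supAbs Ω u + supAbs Ω v + |μ|

/-- `K_a = min {inf_Ω D_x, inf_Ω D_y, μ}`. -/
def coerConst (Ω : Set (ℝ × ℝ)) (Dx Dy : ℝ × ℝ → ℝ) (μ : ℝ) : ℝ :=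
  min (min (sInf (Dx '' Ω)) (sInf (Dy '' Ω))) μ

end ADR

end

open MeasureTheory

noncomputable section

namespace ADR

/-! ### Multiplication by a bounded coefficient -/

/-! The map `f ↦ (f, ∂f/∂x, ∂f/∂y)` carries `H¹₀(Ω)` with the `H¹` norm isometrically into the
Hilbert space of triples in `L²(Ω)`. There the coefficients act as bounded multiplication operators,
so `a` is the restriction of a continuous bilinear form defined on all triples (`bilin_eq`), and
Cauchy–Schwarz gives `N_a` term by term. For a test function, `φ ∇φ = ½ ∇(φ²)`, so zero divergence
tested against `φ²` kills the advection term on the diagonal; density of test functions extends this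
to `H¹₀(Ω)` (`advectionForm_self`). What remains of `a(d,d)` controls the three squared norms
separately, with least factor `K_a`. Weak derivatives pass to `L²` limits, so the image of `H¹₀(Ω)`
is closed, hence complete (`isClosed_range_jetLin`), and Lax–Milgram applies on that image. -/

theorem supAbs_nonneg (Ω : Set (ℝ × ℝ)) (f : ℝ × ℝ → ℝ) : 0 ≤ supAbs Ω f := by
  refine Real.sSup_nonneg ?_
  rintro _ ⟨p, -, rfl⟩
  exact abs_nonneg _

theorem IsBoundedCoeff.ae_norm_mul_le {Ω : Set (ℝ × ℝ)} (hΩ : IsOpen Ω) {f : ℝ × ℝ → ℝ}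
    (hf : IsBoundedCoeff Ω f) (g : ℝ × ℝ → ℝ) :
    ∀ᵐ p ∂volume.restrict Ω, ‖f p * g p‖ ≤ supAbs Ω f * ‖g p‖ := by
  filter_upwards [ae_restrict_mem hΩ.measurableSet] with p hp
  rw [norm_mul]
  exact mul_le_mul_of_nonneg_right (le_csSup hf.bounded ⟨p, hp, rfl⟩) (norm_nonneg _)

theorem IsBoundedCoeff.memLp_mul {Ω : Set (ℝ × ℝ)} (hΩ : IsOpen Ω) {f : ℝ × ℝ → ℝ}
    (hf : IsBoundedCoeff Ω f) (g : L2 Ω) : MemLp (fun p => f p * g p) 2 (volume.restrict Ω) :=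
  (Lp.memLp g).of_le_mul
    (hf.measurable.aestronglyMeasurable.mul (Lp.aestronglyMeasurable g))
    (hf.ae_norm_mul_le hΩ g)

/-- Multiplication by a bounded coefficient, as an operator on `L²(Ω)`. -/
def mulL2 {Ω : Set (ℝ × ℝ)} (hΩ : IsOpen Ω) {f : ℝ × ℝ → ℝ} (hf : IsBoundedCoeff Ω f) :
    L2 Ω →L[ℝ] L2 Ω :=
  LinearMap.mkContinuous
    { toFun := fun g => (hf.memLp_mul hΩ g).toLp _
      map_add' := by
        intro g h
        refine Lp.ext ?_
        filter_upwards [(hf.memLp_mul hΩ (g + h)).coeFn_toLp, (hf.memLp_mul hΩ g).coeFn_toLp,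
          (hf.memLp_mul hΩ h).coeFn_toLp, Lp.coeFn_add g h,
          Lp.coeFn_add ((hf.memLp_mul hΩ g).toLp _) ((hf.memLp_mul hΩ h).toLp _)]
          with p h1 h2 h3 h4 h5
        rw [h1, h5, Pi.add_apply, h2, h3, h4, Pi.add_apply, mul_add]
      map_smul' := by
        intro r g
        refine Lp.ext ?_
        filter_upwards [(hf.memLp_mul hΩ (r • g)).coeFn_toLp, (hf.memLp_mul hΩ g).coeFn_toLp,
          Lp.coeFn_smul r g, Lp.coeFn_smul r ((hf.memLp_mul hΩ g).toLp _)]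
          with p h1 h2 h3 h4
        rw [h1, RingHom.id_apply, h4, Pi.smul_apply, h2, h3, Pi.smul_apply, smul_eq_mul,
          smul_eq_mul, mul_left_comm] }
    (supAbs Ω f) (by
      intro g
      refine Lp.norm_le_mul_norm_of_ae_le_mul ?_
      filter_upwards [(hf.memLp_mul hΩ g).coeFn_toLp, hf.ae_norm_mul_le hΩ g] with p h1 h2
      simp only [LinearMap.coe_mk, AddHom.coe_mk]
      rw [h1]
      exact h2)

theorem coeFn_mulL2 {Ω : Set (ℝ × ℝ)} (hΩ : IsOpen Ω) {f : ℝ × ℝ → ℝ}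
    (hf : IsBoundedCoeff Ω f) (g : L2 Ω) :
    mulL2 hΩ hf g =ᵐ[volume.restrict Ω] fun p => f p * g p :=
  (hf.memLp_mul hΩ g).coeFn_toLp

theorem norm_mulL2_le {Ω : Set (ℝ × ℝ)} (hΩ : IsOpen Ω) {f : ℝ × ℝ → ℝ}
    (hf : IsBoundedCoeff Ω f) (g : L2 Ω) : ‖mulL2 hΩ hf g‖ ≤ supAbs Ω f * ‖g‖ :=
  ContinuousLinearMap.le_of_opNorm_le _
    (LinearMap.mkContinuous_norm_le _ (supAbs_nonneg Ω f) _) g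

theorem inner_L2 {Ω : Set (ℝ × ℝ)} (g h : L2 Ω) : inner ℝ g h = ∫ p in Ω, g p * h p := by
  rw [L2.inner_def]
  simp only [RCLike.inner_apply, conj_trivial, mul_comm]

theorem inner_mulL2 {Ω : Set (ℝ × ℝ)} (hΩ : IsOpen Ω) {f : ℝ × ℝ → ℝ}
    (hf : IsBoundedCoeff Ω f) (g h : L2 Ω) :
    inner ℝ (mulL2 hΩ hf g) h = ∫ p in Ω, f p * g p * h p := by
  rw [inner_L2]
  refine integral_congr_ae ?_
  filter_upwards [coeFn_mulL2 hΩ hf g] with p hp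
  rw [hp]

theorem mul_norm_sq_le_inner_mulL2 {Ω : Set (ℝ × ℝ)} (hΩ : IsOpen Ω) {f : ℝ × ℝ → ℝ}
    (hf : IsBoundedCoeff Ω f) {m : ℝ} (hm : ∀ p ∈ Ω, m ≤ f p) (g : L2 Ω) :
    m * ‖g‖ ^ 2 ≤ inner ℝ (mulL2 hΩ hf g) g := by
  rw [← real_inner_self_eq_norm_sq, inner_L2, inner_L2, ← integral_const_mul]
  refine integral_mono_ae (((Lp.memLp g).integrable_mul (Lp.memLp g)).const_mul m)
    ((Lp.memLp (mulL2 hΩ hf g)).integrable_mul (Lp.memLp g)) ?_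
  filter_upwards [coeFn_mulL2 hΩ hf g, ae_restrict_mem hΩ.measurableSet] with p hp hpΩ
  rw [hp, mul_assoc]
  exact mul_le_mul_of_nonneg_right (hm p hpΩ) (mul_self_nonneg _)

/-! ### Weak derivatives of test functions -/

/-- The class of a test function in `L²(Ω)`. -/
def IsTestFunction.toL2 {Ω : Set (ℝ × ℝ)} {φ : ℝ × ℝ → ℝ} (hφ : IsTestFunction Ω φ) : L2 Ω :=
  hφ.memLp.toLp φ

/-- The class in `L²(Ω)` of a partial derivative of a test function. -/
def IsTestFunction.partialL2 {Ω : Set (ℝ × ℝ)} {φ : ℝ × ℝ → ℝ} (hφ : IsTestFunction Ω φ)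
    (e : ℝ × ℝ) : L2 Ω :=
  (hφ.memLp_fderiv e).toLp _

/-- Pairing with fixed vectors of `L²(Ω)` makes the condition visibly stable under `L²` limits. -/
theorem hasWeakPartial_iff_inner {Ω : Set (ℝ × ℝ)} {e : ℝ × ℝ} {f g : L2 Ω} :
    HasWeakPartial Ω e f g ↔ ∀ (φ : ℝ × ℝ → ℝ) (hφ : IsTestFunction Ω φ),
      inner ℝ f (hφ.partialL2 e) = - inner ℝ g hφ.toL2 := by
  refine forall_congr' fun φ => forall_congr' fun hφ => ?_
  have h1 : inner ℝ f (hφ.partialL2 e) = ∫ p in Ω, f p * fderiv ℝ φ p e := by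
    rw [inner_L2]
    refine integral_congr_ae ?_
    filter_upwards [(hφ.memLp_fderiv e).coeFn_toLp] with p hp
    rw [IsTestFunction.partialL2, hp]
  have h2 : inner ℝ g hφ.toL2 = ∫ p in Ω, g p * φ p := by
    rw [inner_L2]
    refine integral_congr_ae ?_
    filter_upwards [hφ.memLp.coeFn_toLp] with p hp
    rw [IsTestFunction.toL2, hp]
  rw [h1, h2]

theorem IsTestFunction.eq_zero {Ω : Set (ℝ × ℝ)} {φ : ℝ × ℝ → ℝ}
    (hφ : IsTestFunction Ω φ) {p : ℝ × ℝ} (hp : p ∉ Ω) : φ p = 0 :=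
  image_eq_zero_of_notMem_tsupport fun h => hp (hφ.support h)

/-- Both functions vanish off `Ω`, so the integrals extend to the whole plane and integration by
parts has no boundary term, whatever the boundary of `Ω`. -/
theorem IsTestFunction.hasWeakPartial {Ω : Set (ℝ × ℝ)} {φ : ℝ × ℝ → ℝ}
    (hφ : IsTestFunction Ω φ) (e : ℝ × ℝ) : HasWeakPartial Ω e hφ.toL2 (hφ.partialL2 e) := by
  intro ψ hψ
  have hc : ∀ {χ : ℝ × ℝ → ℝ}, IsTestFunction Ω χ → Continuous fun p => fderiv ℝ χ p e :=
    fun hχ => (hχ.smooth.continuous_fderiv (by simp)).clm_apply continuous_const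
  have h1 : ∫ p in Ω, hφ.toL2 p * fderiv ℝ ψ p e = ∫ p, φ p * fderiv ℝ ψ p e := by
    have h0 : ∫ p in Ω, φ p * fderiv ℝ ψ p e = ∫ p, φ p * fderiv ℝ ψ p e :=
      setIntegral_eq_integral_of_forall_compl_eq_zero fun p hp => by rw [hφ.eq_zero hp, zero_mul]
    rw [← h0]
    refine integral_congr_ae ?_
    filter_upwards [hφ.memLp.coeFn_toLp] with p hp
    rw [IsTestFunction.toL2, hp]
  have h2 : ∫ p in Ω, hφ.partialL2 e p * ψ p = ∫ p, fderiv ℝ φ p e * ψ p := by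
    have h0 : ∫ p in Ω, fderiv ℝ φ p e * ψ p = ∫ p, fderiv ℝ φ p e * ψ p :=
      setIntegral_eq_integral_of_forall_compl_eq_zero fun p hp => by rw [hψ.eq_zero hp, mul_zero]
    rw [← h0]
    refine integral_congr_ae ?_
    filter_upwards [(hφ.memLp_fderiv e).coeFn_toLp] with p hp
    rw [IsTestFunction.partialL2, hp]
  rw [h1, h2]
  have cφ := hφ.smooth.continuous
  have cψ := hψ.smooth.continuous
  exact integral_mul_fderiv_eq_neg_fderiv_mul_of_integrable
    (((hc hφ).mul cψ).integrable_of_hasCompactSupport hψ.compact.mul_left)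
    ((cφ.mul (hc hψ)).integrable_of_hasCompactSupport hφ.compact.mul_right)
    ((cφ.mul cψ).integrable_of_hasCompactSupport hφ.compact.mul_right)
    (fun p _ => hφ.smooth.differentiable (by simp) p)
    (fun p _ => hψ.smooth.differentiable (by simp) p)

theorem IsTestFunction.toL2_mem_H10 {Ω : Set (ℝ × ℝ)} (hΩ : IsOpen Ω) {φ : ℝ × ℝ → ℝ}
    (hφ : IsTestFunction Ω φ) : hφ.toL2 ∈ H10 Ω hΩ := by
  have hm : hφ.toL2 ∈ H1 Ω := ⟨⟨_, hφ.hasWeakPartial ex⟩, _, hφ.hasWeakPartial ey⟩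
  refine ⟨hm, fun ε hε => ⟨φ, hφ, _, hm, hφ.memLp.coeFn_toLp, ?_⟩⟩
  -- Homogeneity with scalar `0` gives `normH1 0 = 0`.
  have := normH1_smul hΩ 0 (H1 Ω).zero_mem
  rw [zero_smul, abs_zero, zero_mul] at this
  rwa [sub_self, this]

/-- Provides the test function against which zero divergence is used. -/
theorem IsTestFunction.sq {Ω : Set (ℝ × ℝ)} {φ : ℝ × ℝ → ℝ} (hφ : IsTestFunction Ω φ) :
    IsTestFunction Ω fun p => φ p * φ p :=
  ⟨hφ.smooth.mul hφ.smooth, hφ.compact.mul_left,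
    (tsupport_mul_subset_right (f := φ) (g := φ)).trans hφ.support⟩

/-! ### The first order jet -/

/-- The Hilbert space of triples in `L²(Ω)`. -/
abbrev JetSpace (Ω : Set (ℝ × ℝ)) : Type := PiLp 2 fun _ : Fin 3 => L2 Ω

/-- The triple `(f, ∂f/∂x, ∂f/∂y)`. -/
def jet {Ω : Set (ℝ × ℝ)} (f : L2 Ω) : JetSpace Ω :=
  WithLp.toLp 2 ![f, weakPartial ex f, weakPartial ey f]

@[simp] theorem jet_zero {Ω : Set (ℝ × ℝ)} (f : L2 Ω) : jet f 0 = f := rfl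

@[simp] theorem jet_one {Ω : Set (ℝ × ℝ)} (f : L2 Ω) : jet f 1 = weakPartial ex f := rfl

@[simp] theorem jet_two {Ω : Set (ℝ × ℝ)} (f : L2 Ω) : jet f 2 = weakPartial ey f := rfl

theorem norm_jet {Ω : Set (ℝ × ℝ)} (f : L2 Ω) : ‖jet f‖ = normH1 f := by
  rw [PiLp.norm_eq_of_L2, normH1, Fin.sum_univ_three, jet_zero, jet_one, jet_two]

/-- Uniqueness of weak derivatives: the relations alone force the last two entries. Linearity of the
jet and closedness of its range both rest on this. -/
theorem jet_eq {Ω : Set (ℝ × ℝ)} (hΩ : IsOpen Ω) {z : JetSpace Ω}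
    (hx : HasWeakPartial Ω ex (z 0) (z 1)) (hy : HasWeakPartial Ω ey (z 0) (z 2)) :
    jet (z 0) = z := by
  ext1 i
  fin_cases i
  · rfl
  · exact weakPartial_eq hΩ hx
  · exact weakPartial_eq hΩ hy

theorem hasWeakPartial_jet {Ω : Set (ℝ × ℝ)} {f : L2 Ω} (hf : f ∈ H1 Ω) :
    HasWeakPartial Ω ex (jet f 0) (jet f 1) ∧ HasWeakPartial Ω ey (jet f 0) (jet f 2) :=
  ⟨hasWeakPartial_weakPartial hf.1, hasWeakPartial_weakPartial hf.2⟩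

theorem jet_add {Ω : Set (ℝ × ℝ)} (hΩ : IsOpen Ω) {f g : L2 Ω} (hf : f ∈ H1 Ω)
    (hg : g ∈ H1 Ω) : jet (f + g) = jet f + jet g :=
  jet_eq hΩ (z := jet f + jet g)
    ((hasWeakPartial_jet hf).1.add (hasWeakPartial_jet hg).1)
    ((hasWeakPartial_jet hf).2.add (hasWeakPartial_jet hg).2)

theorem jet_smul {Ω : Set (ℝ × ℝ)} (hΩ : IsOpen Ω) (r : ℝ) {f : L2 Ω} (hf : f ∈ H1 Ω) :
    jet (r • f) = r • jet f :=
  jet_eq hΩ (z := r • jet f) ((hasWeakPartial_jet hf).1.smul r) ((hasWeakPartial_jet hf).2.smul r)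

/-- An intersection, over test functions, of equalities between continuous functions of the triple.
-/
theorem isClosed_setOf_hasWeakPartial {Ω : Set (ℝ × ℝ)} (e : ℝ × ℝ) (i j : Fin 3) :
    IsClosed {z : JetSpace Ω | HasWeakPartial Ω e (z i) (z j)} := by
  simp only [hasWeakPartial_iff_inner, Set.ofPred_forall]
  refine isClosed_iInter fun φ => isClosed_iInter fun hφ => isClosed_eq ?_ ?_ <;> fun_prop

/-- The jet as a linear map on `H¹₀(Ω)`. -/
def jetLin {Ω : Set (ℝ × ℝ)} (hΩ : IsOpen Ω) : H10 Ω hΩ →ₗ[ℝ] JetSpace Ω where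
  toFun f := jet (f : L2 Ω)
  map_add' f g := jet_add hΩ f.2.1 g.2.1
  map_smul' r f := jet_smul hΩ r f.2.1

theorem jetLin_apply {Ω : Set (ℝ × ℝ)} (hΩ : IsOpen Ω) (f : H10 Ω hΩ) :
    jetLin hΩ f = jet (f : L2 Ω) := rfl

/-- The defining density of test functions in `H¹₀(Ω)`, transported to the norm of triples. -/
theorem exists_test_norm_jet_sub_lt {Ω : Set (ℝ × ℝ)} (hΩ : IsOpen Ω) (f : H10 Ω hΩ) {ε : ℝ}
    (hε : 0 < ε) : ∃ (φ : ℝ × ℝ → ℝ) (hφ : IsTestFunction Ω φ),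
      ‖jet (f : L2 Ω) - jet hφ.toL2‖ < ε := by
  obtain ⟨φ, hφ, w, hw, hwφ, hlt⟩ := f.2.2 ε hε
  have hwe : w = hφ.toL2 := Lp.ext (hwφ.trans hφ.memLp.coeFn_toLp.symm)
  subst hwe
  refine ⟨φ, hφ, ?_⟩
  have := (jetLin hΩ).map_sub f ⟨_, hφ.toL2_mem_H10 hΩ⟩
  simp only [jetLin_apply, Submodule.coe_sub] at this
  rwa [← this, norm_jet]

/-- This is the completeness of `H¹₀(Ω)`. A limit of jets still satisfies the weak derivative
relations, hence is a jet; its first entry is approximated by test functions through a nearby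
element of the range. -/
theorem isClosed_range_jetLin {Ω : Set (ℝ × ℝ)} (hΩ : IsOpen Ω) :
    IsClosed (LinearMap.range (jetLin hΩ) : Set (JetSpace Ω)) := by
  refine isClosed_of_closure_subset fun z hz => ?_
  have hsub : (LinearMap.range (jetLin hΩ) : Set (JetSpace Ω)) ⊆
      {z | HasWeakPartial Ω ex (z 0) (z 1)} ∩ {z | HasWeakPartial Ω ey (z 0) (z 2)} := by
    rintro _ ⟨f, rfl⟩
    exact hasWeakPartial_jet f.2.1
  obtain ⟨hx, hy⟩ := closure_minimal hsub ((isClosed_setOf_hasWeakPartial ex 0 1).inter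
    (isClosed_setOf_hasWeakPartial ey 0 2)) hz
  have hj : jet (z 0) = z := jet_eq hΩ hx hy
  have hm : z 0 ∈ H1 Ω := ⟨⟨_, hx⟩, _, hy⟩
  refine ⟨⟨z 0, hm, fun ε hε => ?_⟩, hj⟩
  obtain ⟨_, ⟨g, rfl⟩, hg⟩ := Metric.mem_closure_iff.mp hz (ε / 2) (half_pos hε)
  obtain ⟨φ, hφ, hlt⟩ := exists_test_norm_jet_sub_lt hΩ g (half_pos hε)
  have hφm := (hφ.toL2_mem_H10 hΩ).1
  refine ⟨φ, hφ, _, hφm, hφ.memLp.coeFn_toLp, ?_⟩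
  rw [dist_eq_norm, jetLin_apply] at hg
  -- So far `z 0` is only known to lie in `H¹(Ω)`, so `jetLin` is not available and linearity comes
  -- from `jet_add` and `jet_smul`.
  have hsplit : jet (z 0 - hφ.toL2) = (z - jet (g : L2 Ω)) + (jet (g : L2 Ω) - jet hφ.toL2) := by
    rw [sub_add_sub_cancel, sub_eq_add_neg, ← neg_one_smul ℝ hφ.toL2,
      jet_add hΩ hm ((H1 Ω).smul_mem _ hφm), jet_smul hΩ _ hφm, hj, neg_one_smul, sub_eq_add_neg]
  rw [← norm_jet, hsplit]
  linarith [norm_add_le (z - jet (g : L2 Ω)) (jet (g : L2 Ω) - jet hφ.toL2)]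

/-! ### The forms on jets -/

/-- The form `(y, z) ↦ ⟨T yᵢ, zⱼ⟩` on triples. -/
def componentForm {Ω : Set (ℝ × ℝ)} (T : L2 Ω →L[ℝ] L2 Ω) (i j : Fin 3) :
    JetSpace Ω →L[ℝ] JetSpace Ω →L[ℝ] ℝ :=
  (innerSL (E := L2 Ω) ℝ).bilinearComp (T.comp (PiLp.proj 2 (fun _ : Fin 3 => L2 Ω) i))
    (PiLp.proj 2 (fun _ : Fin 3 => L2 Ω) j)

@[simp] theorem componentForm_apply {Ω : Set (ℝ × ℝ)} (T : L2 Ω →L[ℝ] L2 Ω) (i j : Fin 3)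
    (y z : JetSpace Ω) : componentForm T i j y z = inner ℝ (T (y i)) (z j) := rfl

theorem abs_componentForm_le {Ω : Set (ℝ × ℝ)} {T : L2 Ω →L[ℝ] L2 Ω} {K : ℝ} (hK : 0 ≤ K)
    (hT : ∀ g, ‖T g‖ ≤ K * ‖g‖) (i j : Fin 3) (y z : JetSpace Ω) :
    |componentForm T i j y z| ≤ K * ‖y‖ * ‖z‖ := by
  refine (abs_real_inner_le_norm (T (y i)) (z j)).trans ?_
  have hy := PiLp.norm_apply_le y i
  have hz := PiLp.norm_apply_le z j
  exact mul_le_mul ((hT _).trans (mul_le_mul_of_nonneg_left hy hK)) hz (norm_nonneg _)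
    (mul_nonneg hK (norm_nonneg _))

/-- The advection form on triples. -/
def advectionForm {Ω : Set (ℝ × ℝ)} (hΩ : IsOpen Ω) {u v : ℝ × ℝ → ℝ}
    (hu : IsBoundedCoeff Ω u) (hv : IsBoundedCoeff Ω v) :
    JetSpace Ω →L[ℝ] JetSpace Ω →L[ℝ] ℝ :=
  componentForm (mulL2 hΩ hu) 1 0 + componentForm (mulL2 hΩ hv) 2 0

/-- The bilinear form of the weak formulation, on triples. -/
def jetForm {Ω : Set (ℝ × ℝ)} (hΩ : IsOpen Ω) {Dx Dy u v : ℝ × ℝ → ℝ} (μ : ℝ)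
    (hDx : IsBoundedCoeff Ω Dx) (hDy : IsBoundedCoeff Ω Dy)
    (hu : IsBoundedCoeff Ω u) (hv : IsBoundedCoeff Ω v) :
    JetSpace Ω →L[ℝ] JetSpace Ω →L[ℝ] ℝ :=
  componentForm (mulL2 hΩ hDx) 1 1 + componentForm (mulL2 hΩ hDy) 2 2 +
    advectionForm hΩ hu hv + componentForm (μ • ContinuousLinearMap.id ℝ (L2 Ω)) 0 0

theorem advection_eq {Ω : Set (ℝ × ℝ)} (hΩ : IsOpen Ω) {u v : ℝ × ℝ → ℝ}
    (hu : IsBoundedCoeff Ω u) (hv : IsBoundedCoeff Ω v) (c d : L2 Ω) :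
    advection u v c d = advectionForm hΩ hu hv (jet c) (jet d) := by
  change _ = inner ℝ (mulL2 hΩ hu (weakPartial ex c)) d + inner ℝ (mulL2 hΩ hv (weakPartial ey c)) d
  have hi : ∀ g : L2 Ω, Integrable (fun p => g p * d p) (volume.restrict Ω) := fun g =>
    (Lp.memLp g).integrable_mul (Lp.memLp d)
  rw [inner_L2, inner_L2, ← integral_add (hi _) (hi _)]
  refine integral_congr_ae ?_
  filter_upwards [coeFn_mulL2 hΩ hu (weakPartial ex c), coeFn_mulL2 hΩ hv (weakPartial ey c)]
    with p h1 h2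
  rw [h1, h2]
  ring

theorem bilin_eq {Ω : Set (ℝ × ℝ)} (hΩ : IsOpen Ω) {Dx Dy u v : ℝ × ℝ → ℝ} (μ : ℝ)
    (hDx : IsBoundedCoeff Ω Dx) (hDy : IsBoundedCoeff Ω Dy)
    (hu : IsBoundedCoeff Ω u) (hv : IsBoundedCoeff Ω v) (c d : L2 Ω) :
    bilin Dx Dy u v μ c d = jetForm hΩ μ hDx hDy hu hv (jet c) (jet d) := by
  have hμ : ∫ p in Ω, μ * c p * d p = inner ℝ (μ • c) d := by
    rw [real_inner_smul_left, inner_L2, ← integral_const_mul]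
    simp only [mul_assoc]
  rw [bilin, advection_eq hΩ hu hv, hμ, ← inner_mulL2 hΩ hDx, ← inner_mulL2 hΩ hDy]
  rfl

/-- Each of the five terms is bounded by its own coefficient's supremum times `‖y‖ * ‖z‖`, which is
why `N_a` is a sum. -/
theorem abs_jetForm_le {Ω : Set (ℝ × ℝ)} (hΩ : IsOpen Ω) {Dx Dy u v : ℝ × ℝ → ℝ} (μ : ℝ)
    (hDx : IsBoundedCoeff Ω Dx) (hDy : IsBoundedCoeff Ω Dy)
    (hu : IsBoundedCoeff Ω u) (hv : IsBoundedCoeff Ω v) (y z : JetSpace Ω) :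
    |jetForm hΩ μ hDx hDy hu hv y z| ≤ contConst Ω Dx Dy u v μ * ‖y‖ * ‖z‖ := by
  have h : ∀ {f : ℝ × ℝ → ℝ} (hf : IsBoundedCoeff Ω f) (i j : Fin 3),
      |componentForm (mulL2 hΩ hf) i j y z| ≤ supAbs Ω f * ‖y‖ * ‖z‖ := fun hf i j =>
    abs_componentForm_le (supAbs_nonneg Ω _) (norm_mulL2_le hΩ hf) i j y z
  have hμ : |componentForm (μ • ContinuousLinearMap.id ℝ (L2 Ω)) 0 0 y z| ≤ |μ| * ‖y‖ * ‖z‖ :=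
    abs_componentForm_le (abs_nonneg μ) (fun g => by
      rw [smul_apply, ContinuousLinearMap.id_apply, norm_smul, Real.norm_eq_abs]) 0 0 y z
  have hs : contConst Ω Dx Dy u v μ * ‖y‖ * ‖z‖ = supAbs Ω Dx * ‖y‖ * ‖z‖ +
      supAbs Ω Dy * ‖y‖ * ‖z‖ + (supAbs Ω u * ‖y‖ * ‖z‖ + supAbs Ω v * ‖y‖ * ‖z‖) +
      |μ| * ‖y‖ * ‖z‖ := by
    rw [contConst]
    ring
  rw [hs]
  simp only [jetForm, advectionForm, add_apply]
  exact (abs_add_le _ _).trans (add_le_add ((abs_add_le _ _).trans (add_le_add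
    ((abs_add_le _ _).trans (add_le_add (h hDx 1 1) (h hDy 2 2)))
    ((abs_add_le _ _).trans (add_le_add (h hu 1 0) (h hv 2 0))))) hμ)

/-! ### Skew-symmetry and coercivity -/

/-- Since `∇(φ²) = 2 φ ∇φ`, twice the integral is the distributional divergence tested on `φ²`. -/
theorem IsTestFunction.advectionForm_self {Ω : Set (ℝ × ℝ)} (hΩ : IsOpen Ω) {u v : ℝ × ℝ → ℝ}
    (hu : IsBoundedCoeff Ω u) (hv : IsBoundedCoeff Ω v) (hdiv : DivergenceFree Ω u v)
    {φ : ℝ × ℝ → ℝ} (hφ : IsTestFunction Ω φ) :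
    advectionForm hΩ hu hv (jet hφ.toL2) (jet hφ.toL2) = 0 := by
  rw [← advection_eq, advection, weakPartial_eq hΩ (hφ.hasWeakPartial ex),
    weakPartial_eq hΩ (hφ.hasWeakPartial ey)]
  have hsq : ∀ p e, fderiv ℝ (fun p => φ p * φ p) p e = 2 * (φ p * fderiv ℝ φ p e) := by
    intro p e
    have hd : DifferentiableAt ℝ φ p := hφ.smooth.differentiable (by simp) p
    rw [fderiv_fun_mul hd hd]
    simp only [add_apply, smul_apply, smul_eq_mul]
    ring
  have h0 : ∫ p in Ω, 2 * (φ p * (u p * fderiv ℝ φ p ex + v p * fderiv ℝ φ p ey)) = 0 := by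
    rw [← hdiv _ hφ.sq]
    refine integral_congr_ae (Filter.Eventually.of_forall fun p => ?_)
    simp only [hsq]
    ring
  rw [integral_const_mul] at h0
  rw [← (mul_eq_zero.mp h0).resolve_left two_ne_zero]
  refine integral_congr_ae ?_
  filter_upwards [hφ.memLp.coeFn_toLp, (hφ.memLp_fderiv ex).coeFn_toLp,
    (hφ.memLp_fderiv ey).coeFn_toLp] with p h1 h2 h3
  rw [IsTestFunction.toL2, IsTestFunction.partialL2, IsTestFunction.partialL2, h1, h2, h3]

/-- The quadratic form is continuous on triples, so its zero set is closed, and jets of test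
functions come arbitrarily close to the jet of `d`. -/
theorem advectionForm_self {Ω : Set (ℝ × ℝ)} (hΩ : IsOpen Ω) {u v : ℝ × ℝ → ℝ}
    (hu : IsBoundedCoeff Ω u) (hv : IsBoundedCoeff Ω v) (hdiv : DivergenceFree Ω u v)
    (d : H10 Ω hΩ) : advectionForm hΩ hu hv (jet (d : L2 Ω)) (jet (d : L2 Ω)) = 0 := by
  have hcl : IsClosed {z : JetSpace Ω | advectionForm hΩ hu hv z z = 0} :=
    isClosed_eq (by fun_prop) continuous_const
  refine hcl.closure_subset (Metric.mem_closure_iff.mpr fun ε hε => ?_)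
  obtain ⟨φ, hφ, hlt⟩ := exists_test_norm_jet_sub_lt hΩ d hε
  exact ⟨jet hφ.toL2, hφ.advectionForm_self hΩ hu hv hdiv, by rwa [dist_eq_norm]⟩

theorem coerConst_pos {Ω : Set (ℝ × ℝ)} (hne : Ω.Nonempty) {Dx Dy : ℝ × ℝ → ℝ} {μ : ℝ}
    (hDx_pos : ∃ m > 0, ∀ p ∈ Ω, m ≤ Dx p) (hDy_pos : ∃ m > 0, ∀ p ∈ Ω, m ≤ Dy p)
    (hμ : 0 < μ) : 0 < coerConst Ω Dx Dy μ := by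
  have h : ∀ D : ℝ × ℝ → ℝ, (∃ m > 0, ∀ p ∈ Ω, m ≤ D p) → 0 < sInf (D '' Ω) := by
    rintro D ⟨m, hm, hle⟩
    -- Nonemptiness matters: the real infimum of the empty set is `0`.
    refine hm.trans_le (le_csInf (hne.image D) ?_)
    rintro _ ⟨p, hp, rfl⟩
    exact hle p hp
  exact lt_min (lt_min (h Dx hDx_pos) (h Dy hDy_pos)) hμ

theorem sInf_image_le {Ω : Set (ℝ × ℝ)} {D : ℝ × ℝ → ℝ} (h : ∃ m > 0, ∀ p ∈ Ω, m ≤ D p) :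
    ∀ p ∈ Ω, sInf (D '' Ω) ≤ D p := by
  obtain ⟨m, -, hm⟩ := h
  refine fun p hp => csInf_le ⟨m, ?_⟩ ⟨p, hp, rfl⟩
  rintro _ ⟨p', hp', rfl⟩
  exact hm p' hp'

/-- Without advection the diagonal is a sum of three weighted squares, one per entry of `z`; the `μ`
term supplies the `L²` part of the norm. The triple need not be a jet. -/
theorem coerConst_mul_le_jetForm {Ω : Set (ℝ × ℝ)} (hΩ : IsOpen Ω) {Dx Dy u v : ℝ × ℝ → ℝ}
    {μ : ℝ} (hDx : IsBoundedCoeff Ω Dx) (hDy : IsBoundedCoeff Ω Dy)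
    (hu : IsBoundedCoeff Ω u) (hv : IsBoundedCoeff Ω v)
    (hDx_pos : ∃ m > 0, ∀ p ∈ Ω, m ≤ Dx p) (hDy_pos : ∃ m > 0, ∀ p ∈ Ω, m ≤ Dy p)
    {z : JetSpace Ω} (hz : advectionForm hΩ hu hv z z = 0) :
    coerConst Ω Dx Dy μ * ‖z‖ ^ 2 ≤ jetForm hΩ μ hDx hDy hu hv z z := by
  have h1 := mul_norm_sq_le_inner_mulL2 hΩ hDx (sInf_image_le hDx_pos) (z 1)
  have h2 := mul_norm_sq_le_inner_mulL2 hΩ hDy (sInf_image_le hDy_pos) (z 2)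
  have h3 : inner ℝ ((μ • ContinuousLinearMap.id ℝ (L2 Ω)) (z 0)) (z 0) = μ * ‖z 0‖ ^ 2 := by
    rw [smul_apply, ContinuousLinearMap.id_apply, real_inner_smul_left,
      real_inner_self_eq_norm_sq]
  have k1 : coerConst Ω Dx Dy μ ≤ sInf (Dx '' Ω) := (min_le_left _ _).trans (min_le_left _ _)
  have k2 : coerConst Ω Dx Dy μ ≤ sInf (Dy '' Ω) := (min_le_left _ _).trans (min_le_right _ _)
  have k3 : coerConst Ω Dx Dy μ ≤ μ := min_le_right _ _
  rw [PiLp.norm_sq_eq_of_L2, Fin.sum_univ_three]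
  simp only [jetForm, add_apply, hz, componentForm_apply, h3]
  have l1 := mul_le_mul_of_nonneg_right k1 (sq_nonneg ‖z 1‖)
  have l2 := mul_le_mul_of_nonneg_right k2 (sq_nonneg ‖z 2‖)
  have l3 := mul_le_mul_of_nonneg_right k3 (sq_nonneg ‖z 0‖)
  linarith

/-- The Lax–Milgram theorem for a form that is coercive on a complete subspace. -/
theorem existsUnique_of_coercive_on {E : Type*} [NormedAddCommGroup E] [InnerProductSpace ℝ E]
    (W : Submodule ℝ E) [CompleteSpace W] (B : E →L[ℝ] E →L[ℝ] ℝ) {K : ℝ} (hK : 0 < K)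
    (hB : ∀ w ∈ W, K * ‖w‖ ^ 2 ≤ B w w) (l : E →L[ℝ] ℝ) :
    ∃! y : W, ∀ w : W, B y w = l w := by
  let B' : W →L[ℝ] W →L[ℝ] ℝ := B.bilinearComp W.subtypeL W.subtypeL
  have hco : IsCoercive B' := ⟨K, hK, fun w => by
    have := hB w w.2
    rw [sq, ← mul_assoc] at this
    exact this⟩
  -- The Riesz representative of `l` restricted to `W`; the solution is its preimage under the
  -- operator of the coercive form.
  let r : W := (InnerProductSpace.toDual ℝ W).symm (l.comp W.subtypeL)
  have hr : ∀ w : W, inner ℝ r w = l w := fun w => by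
    rw [InnerProductSpace.toDual_symm_apply]
    rfl
  refine ⟨hco.continuousLinearEquivOfBilin.symm r, fun w => ?_, fun y hy => ?_⟩
  · have := hco.continuousLinearEquivOfBilin_apply (hco.continuousLinearEquivOfBilin.symm r) w
    rw [ContinuousLinearEquiv.apply_symm_apply, hr] at this
    exact this.symm
  · rw [ContinuousLinearEquiv.eq_symm_apply]
    refine (hco.unique_continuousLinearEquivOfBilin fun w => ?_).symm
    exact (hr w).trans (hy w).symm

end ADR

end

theorem mainTheorem6 (Ω : Set (ℝ × ℝ)) (hΩ : IsOpen Ω) (hbdd : Bornology.IsBounded Ω)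
    (hne : Ω.Nonempty) (Dx Dy u v : ℝ × ℝ → ℝ) (μ : ℝ) (q : ADR.L2 Ω)
    (hDx : ADR.IsBoundedCoeff Ω Dx) (hDy : ADR.IsBoundedCoeff Ω Dy)
    (hu : ADR.IsBoundedCoeff Ω u) (hv : ADR.IsBoundedCoeff Ω v)
    (hDx_pos : ∃ m > 0, ∀ p ∈ Ω, m ≤ Dx p) (hDy_pos : ∃ m > 0, ∀ p ∈ Ω, m ≤ Dy p)
    (hμ : 0 < μ) (hdiv : ADR.DivergenceFree Ω u v) :
    -- `a` is a bilinear form on `V = H¹₀(Ω)`, continuous with constant `N_a`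
    (∀ c : ADR.H10 Ω hΩ,
      IsLinearMap ℝ (fun d : ADR.H10 Ω hΩ => ADR.bilin Dx Dy u v μ (c : ADR.L2 Ω) d)) ∧
    (∀ d : ADR.H10 Ω hΩ,
      IsLinearMap ℝ (fun c : ADR.H10 Ω hΩ => ADR.bilin Dx Dy u v μ (c : ADR.L2 Ω) d)) ∧
    (∀ c d : ADR.H10 Ω hΩ, |ADR.bilin Dx Dy u v μ (c : ADR.L2 Ω) d| ≤
      ADR.contConst Ω Dx Dy u v μ * ADR.normH1 (c : ADR.L2 Ω) * ADR.normH1 (d : ADR.L2 Ω)) ∧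
    -- the advection term vanishes on the diagonal, and `a` is coercive with constant `K_a`
    (∀ d : ADR.H10 Ω hΩ, ADR.advection u v (d : ADR.L2 Ω) d = 0) ∧
    0 < ADR.coerConst Ω Dx Dy μ ∧
    (∀ d : ADR.H10 Ω hΩ,
      ADR.coerConst Ω Dx Dy μ * ADR.normH1 (d : ADR.L2 Ω) ^ 2 ≤
        ADR.bilin Dx Dy u v μ (d : ADR.L2 Ω) d) ∧
    -- `l` is a linear functional on `V`, continuous with constant `‖q‖`
    IsLinearMap ℝ (fun d : ADR.H10 Ω hΩ => ADR.source q (d : ADR.L2 Ω)) ∧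
    (∀ d : ADR.H10 Ω hΩ, |ADR.source q (d : ADR.L2 Ω)| ≤ ‖q‖ * ADR.normH1 (d : ADR.L2 Ω)) ∧
    -- the weak form has exactly one solution in `V`
    ∃! c : ADR.H10 Ω hΩ, ∀ d : ADR.H10 Ω hΩ,
      ADR.bilin Dx Dy u v μ (c : ADR.L2 Ω) d = ADR.source q (d : ADR.L2 Ω) := by
  have hb := ADR.bilin_eq hΩ μ hDx hDy hu hv
  have hs : ∀ d : ADR.L2 Ω, ADR.source q d =
      (innerSL ℝ q).comp (PiLp.proj 2 (fun _ : Fin 3 => ADR.L2 Ω) 0) (ADR.jet d) :=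
    fun d => (ADR.inner_L2 q d).symm
  have hadv := ADR.advectionForm_self hΩ hu hv hdiv
  have hpos : 0 < ADR.coerConst Ω Dx Dy μ := ADR.coerConst_pos hne hDx_pos hDy_pos hμ
  have hcoer : ∀ d : ADR.H10 Ω hΩ, _ := fun d =>
    ADR.coerConst_mul_le_jetForm (μ := μ) hΩ hDx hDy hu hv hDx_pos hDy_pos (hadv d)
  simp only [hb, hs, ADR.advection_eq hΩ hu hv, ← ADR.norm_jet]
  refine ⟨fun c => ?_, fun d => ?_, fun c d => ADR.abs_jetForm_le hΩ μ hDx hDy hu hv _ _, hadv,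
    hpos, hcoer, ?_, fun d => ?_, ?_⟩
  · exact ((ADR.jetForm hΩ μ hDx hDy hu hv (ADR.jet (c : ADR.L2 Ω))).toLinearMap ∘ₗ
      ADR.jetLin hΩ).isLinear
  · exact (((ADR.jetForm hΩ μ hDx hDy hu hv).flip (ADR.jet (d : ADR.L2 Ω))).toLinearMap ∘ₗ
      ADR.jetLin hΩ).isLinear
  · exact (((innerSL ℝ q).comp (PiLp.proj 2 (fun _ : Fin 3 => ADR.L2 Ω) 0)).toLinearMap ∘ₗ
      ADR.jetLin hΩ).isLinear
  · exact (abs_real_inner_le_norm _ _).trans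
      (mul_le_mul_of_nonneg_left (PiLp.norm_apply_le (ADR.jet (d : ADR.L2 Ω)) 0) (norm_nonneg q))
  -- Lax–Milgram is run on the range of the jet: `H10 Ω hΩ` itself inherits the `L²` norm, which is
  -- not the norm of the coercivity bound.
  · have : CompleteSpace (LinearMap.range (ADR.jetLin hΩ)) :=
      (ADR.isClosed_range_jetLin hΩ).completeSpace_coe
    obtain ⟨⟨_, c, rfl⟩, hc, huniq⟩ := ADR.existsUnique_of_coercive_on
      (LinearMap.range (ADR.jetLin hΩ)) (ADR.jetForm hΩ μ hDx hDy hu hv) hpos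
      (by rintro _ ⟨d, rfl⟩; exact hcoer d)
      ((innerSL ℝ q).comp (PiLp.proj 2 (fun _ : Fin 3 => ADR.L2 Ω) 0))
    refine ⟨c, fun d => hc ⟨_, d, rfl⟩, fun c' hc' => ?_⟩
    have := huniq ⟨_, c', rfl⟩ (by rintro ⟨_, d, rfl⟩; exact hc' d)
    -- Entry `0` of a jet is the function itself, so equal jets give equal solutions.
    exact Subtype.ext (congrArg (fun z : ADR.JetSpace Ω => z 0) (Subtype.ext_iff.mp this))
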